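/- **Setting.** Let $\alpha_1,\alpha_2,\alpha_3,\beta>-1$ be real with $\alpha_i-\alpha_j\notin\mathbb Z$ for $i\ne j$, and let $\mathrm d\mu=[\mathrm d\mu_1,\mathrm d\mu_2,\mathrm d\mu_3]$ with $\mathrm d\mu_a(x)=x^{\alpha_a}(1-x)^\beta\,\mathrm dx$ on $[0,1]$ (Jacobi–Piñeiro, $p=3$, $q=1$). For a row $\mathrm d\nu=[\mathrm d\nu_1,\mathrm d\nu_2,\mathrm d\nu_3]$ of (possibly complex) measures with finite moments, let $\mathscr M$ be the semi-infinite moment matrix with entries $\mathscr M_{i,j}=\int x^{i+\lfloor j/3\rfloor}\,\mathrm d\nu_{(j \bmod 3)+1}(x)$, $i,j\ge 0$. If all leading principal submatrices of $\mathscr M$ are invertible, the step-line multiple orthogonal polynomials of $\mathrm d\nu$ are the unique polynomials $B_n$ (type II) and $A_n=(A_n^{(1)},A_n^{(2)},A_n^{(3)})$ (type I), $n\ge 0$, such that $B_n$ is monic of degree $n$, the coefficient of $x^l$ in $A_n^{(a)}$ vanishes when $3l+a-1>n$, and $$\int B_m\sum_{a=1}^3 A_n^{(a)}\,\mathrm d\nu_a=\delta_{m,n}\qquad(m,n\ge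 0).$$ Write $P_n^{(a)}=A_n^{(a)}$ and $B_n$ for these polynomials when $\mathrm d\nu=\mathrm d\mu$ (so $P_n^{(a)}$ is the classical type I Jacobi–Piñeiro polynomial with step-line multi-index of length $n+1$). Let $c,d\in(-\infty,0]\cup[1,\infty)$, let $\boldsymbol\xi=(\xi_1,\xi_2,\xi_3)$ be an arbitrary complex-valued row function, and assume that $x^{\alpha_a}(1-x)^\beta/(c-x)$ is integrable on $(0,1)$ for $a=1,2,3$ (this is automatic if $c\notin[0,1]$; it means $\beta>0$ if $c=1$, and $\alpha_1,\alpha_2,\alpha_3>0$ if $c=0$). Consider the perturbation $(c-x)\,\mathrm d\tilde\mu_1(x)=\mathrm d\mu(x)P_1(x)$ given by $$\mathrm d\tilde\mu_1(x)=\frac{\mathrm d\mu(x)\,P_1(x)}{c-x}+\delta(x-c)\,\boldsymbol\xi(x)P_1(x),\qquad P_1(x)=\begin{bmatrix}0&x-d&0\\0&0&x-d\\1&0&0\end{bmatrix}.$$ Assume that all leading principal submatrices of the moment matrix of $\mathrm d\tilde\mu_1$ are invertible, and denote its type I and type II polynomials by $\tilde P_n^{(a)}$ and $\tilde P_n$.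 Put $$C_n(c)=\int_0^1\sum_{a=1}^3\frac{P_n^{(a)}(x)}{c-x}\,\mathrm d\mu_a(x),\qquad W_n(c)=C_n(c)+\sum_{j=1}^3\xi_j(c)P_n^{(j)}(c),$$ $$\Delta_{i,j,k}=\begin{vmatrix}P_i^{(1)}(d)&P_j^{(1)}(d)&P_k^{(1)}(d)\\P_i^{(2)}(d)&P_j^{(2)}(d)&P_k^{(2)}(d)\\W_i(c)&W_j(c)&W_k(c)\end{vmatrix},\qquad \tau_n=\Delta_{n,n+1,n+2}.$$ **Proposition (Christoffel-type formulas for $\mathrm d\tilde\mu_1$).** For every $n>0$ one has $\tau_n\neq0$; for $a\in\{1,2,3\}$, $$\left(\begin{bmatrix}(x-d)\tilde P_n^{(2)}(x)\\(x-d)\tilde P_n^{(3)}(x)\\\tilde P_n^{(1)}(x)\end{bmatrix}\right)_a=-\frac1{\tau_n}\begin{vmatrix}P_{n-1}^{(a)}(x)&P_{n-1}^{(1)}(d)&P_{n-1}^{(2)}(d)&W_{n-1}(c)\\P_n^{(a)}(x)&P_n^{(1)}(d)&P_n^{(2)}(d)&W_n(c)\\P_{n+1}^{(a)}(x)&P_{n+1}^{(1)}(d)&P_{n+1}^{(2)}(d)&W_{n+1}(c)\\P_{n+2}^{(a)}(x)&P_{n+2}^{(1)}(d)&P_{n+2}^{(2)}(d)&W_{n+2}(c)\end{vmatrix};$$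 and $$\tilde P_{n+1}(x)=(x-c)B_n(x)+\frac{x-c}{\tau_n}\sum_{i=0}^{n-1}\Delta_{i,n+1,n+2}\,B_i(x)+\frac1{\tau_n}\begin{vmatrix}P_{n+1}^{(1)}(d)&P_{n+2}^{(1)}(d)\\P_{n+1}^{(2)}(d)&P_{n+2}^{(2)}(d)\end{vmatrix}.$$ -/

import Mathlib

open Polynomial

noncomputable section

namespace JacobiPineiro

/-! ### Step-line multiple orthogonal polynomials for a row of three functionals

Components are indexed by `Fin 3` (so `0, 1, 2` stand for the components `1, 2, 3`).  A row
`dν = [dν₁, dν₂, dν₃]` of (signed or complex) measures enters only through the integrals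
`ν a f = ∫ f dν_a` of polynomials. -/

/-- The component `j mod 3` of the step-line index `j`: the `j`-th entry of the row of monomials
`X_{[3]}ᵀ = [I₃, x I₃, x² I₃, …]` is `x^(j / 3)`, in component `j mod 3`. -/
def stepComp (j : ℕ) : Fin 3 := ⟨j % 3, Nat.mod_lt j (by norm_num)⟩

/-- Entry `(i, j)` of the moment matrix `∫ X_{[1]}(x) dν(x) X_{[3]}(x)ᵀ`. -/
def moment (ν : Fin 3 → ℂ[X] → ℂ) (i j : ℕ) : ℂ :=
  ν (stepComp j) (X ^ i * X ^ (j / 3))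

/-- The `k × k` leading principal submatrix of the moment matrix. -/
def momentMatrix (ν : Fin 3 → ℂ[X] → ℂ) (k : ℕ) : Matrix (Fin k) (Fin k) ℂ :=
  Matrix.of fun i j => moment ν i j

/-- The Gauss–Borel (LU) factorization of the moment matrix exists: all leading principal
submatrices are invertible. -/
def GaussBorel (ν : Fin 3 → ℂ[X] → ℂ) : Prop :=
  ∀ k : ℕ, (momentMatrix ν k).det ≠ 0

/-- The type I polynomials `A_n = (A_n^{(1)}, A_n^{(2)}, A_n^{(3)})`: the only combination of the
step-line monomials of index `0, …, n` with `∑ₐ ∫ x^k A_n^{(a)} dν_a = δ_{k,n}` for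
`0 ≤ k ≤ n`, that is, with coefficient vector `(momentMatrix ν (n+1))⁻¹ e_n`. -/
def typeI (ν : Fin 3 → ℂ[X] → ℂ) (n : ℕ) (a : Fin 3) : ℂ[X] :=
  ∑ j : Fin (n + 1),
    if stepComp j = a then C ((momentMatrix ν (n + 1))⁻¹ j (Fin.last n)) * X ^ ((j : ℕ) / 3) else 0

/-- The monic type II polynomial `B_n` of degree `n`: the only monic polynomial of degree `n` that
is orthogonal to the step-line monomials of index `0, …, n - 1`. -/
def typeII (ν : Fin 3 → ℂ[X] → ℂ) (n : ℕ) : ℂ[X] :=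
  X ^ n - ∑ i : Fin n,
    C (∑ j : Fin n, moment ν n j * (momentMatrix ν n)⁻¹ j i) * X ^ (i : ℕ)

/-! ### The Jacobi–Piñeiro measures and the perturbation -/

/-- The density `x^{α_a} (1 - x)^β` of `dμ_a` on `[0, 1]`. -/
def weight (α : Fin 3 → ℝ) (β : ℝ) (a : Fin 3) (x : ℝ) : ℝ :=
  x ^ α a * (1 - x) ^ β

/-- `f ↦ ∫ f dμ_a`. -/
def jp (α : Fin 3 → ℝ) (β : ℝ) (a : Fin 3) (f : ℂ[X]) : ℂ :=
  ∫ x in (0 : ℝ)..1, f.eval (x : ℂ) * (weight α β a x : ℂ)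

/-- The matrix polynomial `P₁(x)`. -/
def P₁ (d x : ℂ) : Matrix (Fin 3) (Fin 3) ℂ :=
  !![0, x - d, 0;
     0, 0, x - d;
     1, 0, 0]

/-- `f ↦ ∫ f dμ̃_a`, where
`dμ̃(x) = dμ(x) P₁(x) / (c - x) + δ(x - c) ξ(x) P₁(x)` is the general solution of
`(c - x) dμ̃(x) = dμ(x) P₁(x)`. -/
def jpPerturbed (α : Fin 3 → ℝ) (β c d : ℝ) (ξ : ℝ → Fin 3 → ℂ) (a : Fin 3) (f : ℂ[X]) : ℂ :=
  (∫ x in (0 : ℝ)..1,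
      f.eval (x : ℂ) * (Matrix.vecMul (fun b => (weight α β b x : ℂ)) (P₁ d x) a / ((c : ℂ) - x)))
    + f.eval (c : ℂ) * Matrix.vecMul (ξ c) (P₁ d c) a

/-- The Jacobi–Piñeiro type I polynomials `P_n^{(a)}`. -/
def P (α : Fin 3 → ℝ) (β : ℝ) (n : ℕ) (a : Fin 3) : ℂ[X] := typeI (jp α β) n a

/-- The monic Jacobi–Piñeiro type II polynomials `B_n`. -/
def B (α : Fin 3 → ℝ) (β : ℝ) (n : ℕ) : ℂ[X] := typeII (jp α β) n

/-- The Cauchy transform `C_n(z) = ∫ ∑ₐ P_n^{(a)}(x) dμ_a(x) / (z - x)` at a real point `z`. -/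
def cauchyC (α : Fin 3 → ℝ) (β : ℝ) (n : ℕ) (z : ℝ) : ℂ :=
  ∫ x in (0 : ℝ)..1,
    (∑ a : Fin 3, (P α β n a).eval (x : ℂ) * (weight α β a x : ℂ)) / ((z : ℂ) - x)

/-- `W_n(c) = C_n(c) + ∑ⱼ ξ_j(c) P_n^{(j)}(c)`. -/
def W (α : Fin 3 → ℝ) (β : ℝ) (ξ : ℝ → Fin 3 → ℂ) (n : ℕ) (c : ℝ) : ℂ :=
  cauchyC α β n c + ∑ j : Fin 3, ξ c j * (P α β n j).eval (c : ℂ)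

/-- The determinant with columns `(P_k^{(1)}(d), P_k^{(2)}(d), W_k(c))`, `k = i, j, l`. -/
def det₃ (α : Fin 3 → ℝ) (β c d : ℝ) (ξ : ℝ → Fin 3 → ℂ) (i j l : ℕ) : ℂ :=
  !![(P α β i 0).eval (d : ℂ), (P α β j 0).eval (d : ℂ), (P α β l 0).eval (d : ℂ);
     (P α β i 1).eval (d : ℂ), (P α β j 1).eval (d : ℂ), (P α β l 1).eval (d : ℂ);
     W α β ξ i c, W α β ξ j c, W α β ξ l c].det

/-- `τ_n`. -/
def τ (α : Fin 3 → ℝ) (β c d : ℝ) (ξ : ℝ → Fin 3 → ℂ) (n : ℕ) : ℂ :=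
  det₃ α β c d ξ n (n + 1) (n + 2)

end JacobiPineiro

end

open JacobiPineiro

/-! The argument is linear algebra around one identity. Let `L a` be integration against dμ_a and
let `Φ a` be integration against dμ_a/(c - x) plus the point mass ξ_a(c) at c, so that Φ((c - x)f) =
L(f) and the perturbed row is Φ P₁. Pairing f and p against the perturbed row is then pairing f and
P₁p against Φ. Every f is a constant plus (x - c)g, and the second part only sees -L(g · P₁p).

The map p ↦ P₁p raises step-line length by 2, and its image is cut out by vanishing at d of the
first two components (`exists_mulP₁_eq`). Together with Φ(1 · R), whose value on a type I polynomial
is W, this gives three boundary functionals, and τ_n is their determinant on A_n, A_{n+1}, A_{n+2}.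

A kernel vector of that determinant would produce a nonzero p contradicting normality of the
perturbed row, so τ_n ≠ 0 (`boundaryDet_ne_zero`). The image under P₁ of a perturbed type I
polynomial is a combination of four consecutive A_k, with known first coefficient and zero boundary
values; Cramer's rule gives the formula (`mulP₁_typeI_eval`). The type II formula is checked by
orthogonality and uniqueness (`typeII_functionalMulP₁`).

Normality of dμ itself (`gaussBorel_jp`) holds because the moments are Beta values at distinct
nodes. -/

noncomputable section

namespace JacobiPineiro

/-! ### Step-line triples and the bilinear pairing -/

/-- The triple of polynomials `p` is a combination of the first `N` step-line monomials. -/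
def StepLt (N : ℕ) (p : Fin 3 → ℂ[X]) : Prop :=
  ∀ (a : Fin 3) (l : ℕ), N ≤ 3 * l + a → (p a).coeff l = 0

/-- The `j`-th step-line monomial, `x^(j / 3)` in component `j mod 3`. -/
def stepMonomial (j : ℕ) : Fin 3 → ℂ[X] := Pi.single (stepComp j) (X ^ (j / 3))

/-- `∑ₐ ∫ f pₐ dν_a`. -/
def pair (L : Fin 3 → ℂ[X] →ₗ[ℂ] ℂ) (f : ℂ[X]) : (Fin 3 → ℂ[X]) →ₗ[ℂ] ℂ :=
  ∑ a, (L a) ∘ₗ (LinearMap.mulLeft ℂ f) ∘ₗ LinearMap.proj a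

theorem pair_apply (L : Fin 3 → ℂ[X] →ₗ[ℂ] ℂ) (f : ℂ[X]) (p : Fin 3 → ℂ[X]) :
    pair L f p = ∑ a, L a (f * p a) := by
  simp [pair]

theorem pair_add_left (L : Fin 3 → ℂ[X] →ₗ[ℂ] ℂ) (f g : ℂ[X]) (p : Fin 3 → ℂ[X]) :
    pair L (f + g) p = pair L f p + pair L g p := by
  simp [pair_apply, add_mul, Finset.sum_add_distrib]

theorem pair_smul_left (L : Fin 3 → ℂ[X] →ₗ[ℂ] ℂ) (r : ℂ) (f : ℂ[X]) (p : Fin 3 → ℂ[X]) :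
    pair L (r • f) p = r * pair L f p := by
  simp [pair_apply, Finset.mul_sum]

/-- The pairing as a linear function of its polynomial argument. -/
def pairLeft (L : Fin 3 → ℂ[X] →ₗ[ℂ] ℂ) (p : Fin 3 → ℂ[X]) : ℂ[X] →ₗ[ℂ] ℂ where
  toFun f := pair L f p
  map_add' f g := pair_add_left L f g p
  map_smul' r f := by simpa using pair_smul_left L r f p

theorem pairLeft_apply (L : Fin 3 → ℂ[X] →ₗ[ℂ] ℂ) (p : Fin 3 → ℂ[X]) (f : ℂ[X]) :
    pairLeft L p f = pair L f p := rfl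

theorem stepMonomial_coeff (j : ℕ) (a : Fin 3) (l : ℕ) :
    (stepMonomial j a).coeff l = if j = 3 * l + a then 1 else 0 := by
  unfold stepMonomial stepComp
  by_cases h : a = ⟨j % 3, Nat.mod_lt j (by norm_num)⟩
  · subst h
    rw [Pi.single_eq_same, coeff_X_pow]
    congr 1
    simp only [eq_iff_iff]
    omega
  · rw [Pi.single_eq_of_ne h, coeff_zero, if_neg]
    intro hj
    apply h
    ext
    simp only
    omega

theorem stepLt_stepMonomial {j N : ℕ} (h : j < N) : StepLt N (stepMonomial j) := by
  intro a l hl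
  rw [stepMonomial_coeff, if_neg (by omega)]

theorem StepLt.mono {N M : ℕ} (h : N ≤ M) {p : Fin 3 → ℂ[X]} (hp : StepLt N p) : StepLt M p :=
  fun a l hl => hp a l (h.trans hl)

theorem StepLt.smul {N : ℕ} {p : Fin 3 → ℂ[X]} (hp : StepLt N p) (r : ℂ) : StepLt N (r • p) := by
  intro a l hl
  simp [hp a l hl]

theorem StepLt.sub {N : ℕ} {p q : Fin 3 → ℂ[X]} (hp : StepLt N p) (hq : StepLt N q) :
    StepLt N (p - q) := by
  intro a l hl
  simp [hp a l hl, hq a l hl]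

theorem StepLt.sum {N : ℕ} {ι : Type*} (s : Finset ι) {p : ι → Fin 3 → ℂ[X]}
    (hp : ∀ i ∈ s, StepLt N (p i)) : StepLt N (∑ i ∈ s, p i) := by
  intro a l hl
  rw [Finset.sum_apply, finsetSum_coeff]
  exact Finset.sum_eq_zero fun i hi => hp i hi a l hl

theorem StepLt.eq_sum {N : ℕ} {p : Fin 3 → ℂ[X]} (hp : StepLt N p) :
    p = ∑ j : Fin N, (p (stepComp j)).coeff ((j : ℕ) / 3) • stepMonomial j := by
  funext a
  ext l
  rw [Finset.sum_apply, finsetSum_coeff]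
  simp only [Pi.smul_apply, coeff_smul, stepMonomial_coeff, smul_eq_mul, mul_ite, mul_one, mul_zero]
  by_cases h : N ≤ 3 * l + a
  · rw [hp a l h, Finset.sum_eq_zero]
    intro j _
    rw [if_neg (by omega)]
  · rw [Finset.sum_eq_single ⟨3 * l + a, not_le.mp h⟩]
    · have h1 : stepComp (3 * l + a) = a := by
        ext; simp only [stepComp]; omega
      have h2 : (3 * l + (a : ℕ)) / 3 = l := by omega
      simp [h1, h2]
    · intro j _ hj
      rw [if_neg]
      intro h'
      exact hj (Fin.ext h')
    · simp

/-! ### Normality, biorthogonality and uniqueness -/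

theorem pair_X_pow_stepMonomial (L : Fin 3 → ℂ[X] →ₗ[ℂ] ℂ) (i j : ℕ) :
    pair L (X ^ i) (stepMonomial j) = moment (fun a => L a) i j := by
  rw [pair_apply, Finset.sum_eq_single (stepComp j)]
  · simp [stepMonomial, moment]
  · intro a _ ha
    simp [stepMonomial, Pi.single_eq_of_ne ha]
  · simp

/-- The coefficient vector lies in the kernel of an invertible moment matrix. -/
theorem StepLt.eq_zero {L : Fin 3 → ℂ[X] →ₗ[ℂ] ℂ} (hL : GaussBorel fun a => L a) {N : ℕ}
    {p : Fin 3 → ℂ[X]} (hp : StepLt N p) (h : ∀ i < N, pair L (X ^ i) p = 0) : p = 0 := by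
  have hv : (momentMatrix (fun a => L a) N).mulVec
      (fun j : Fin N => (p (stepComp j)).coeff ((j : ℕ) / 3)) = 0 := by
    funext i
    have := h i i.2
    rw [hp.eq_sum, map_sum] at this
    simp only [map_smul, pair_X_pow_stepMonomial, smul_eq_mul] at this
    rw [Pi.zero_apply, ← this]
    simp [Matrix.mulVec, dotProduct, momentMatrix, mul_comm]
  have h0 := Matrix.eq_zero_of_mulVec_eq_zero (hL N) hv
  rw [hp.eq_sum]
  exact Finset.sum_eq_zero fun j _ => by rw [congrFun h0 j]; simp

theorem typeI_eq_sum (ν : Fin 3 → ℂ[X] → ℂ) (n : ℕ) :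
    typeI ν n = ∑ j : Fin (n + 1),
      (momentMatrix ν (n + 1))⁻¹ j (Fin.last n) • stepMonomial j := by
  funext a
  rw [Finset.sum_apply]
  refine Finset.sum_congr rfl fun j _ => ?_
  by_cases h : stepComp j = a
  · subst h
    simp [stepMonomial, smul_eq_C_mul]
  · simp [stepMonomial, h]

theorem stepLt_typeI (ν : Fin 3 → ℂ[X] → ℂ) (n : ℕ) : StepLt (n + 1) (typeI ν n) := by
  rw [typeI_eq_sum]
  exact StepLt.sum _ fun j _ => (stepLt_stepMonomial j.2).smul _

theorem pair_X_pow_typeI {L : Fin 3 → ℂ[X] →ₗ[ℂ] ℂ} (hL : GaussBorel fun a => L a) {i n : ℕ}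
    (hi : i ≤ n) : pair L (X ^ i) (typeI (fun a => L a) n) = if i = n then 1 else 0 := by
  rw [typeI_eq_sum, map_sum]
  simp only [map_smul, pair_X_pow_stepMonomial, smul_eq_mul]
  have h := congrFun (congrFun (Matrix.mul_nonsing_inv (momentMatrix (fun a => L a) (n + 1))
    (hL (n + 1)).isUnit) ⟨i, by omega⟩) (Fin.last n)
  rw [Matrix.mul_apply, Matrix.one_apply] at h
  simp only [momentMatrix, Matrix.of_apply, Fin.ext_iff, Fin.val_last] at h
  rw [← h]
  exact Finset.sum_congr rfl fun j _ => mul_comm _ _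

/-- The type I polynomials extract the top coefficient. -/
theorem pair_typeI {L : Fin 3 → ℂ[X] →ₗ[ℂ] ℂ} (hL : GaussBorel fun a => L a) {n : ℕ} {f : ℂ[X]}
    (hf : f.natDegree ≤ n) : pair L f (typeI (fun a => L a) n) = f.coeff n := by
  conv_lhs => rw [f.as_sum_range_C_mul_X_pow' (Nat.lt_succ_of_le hf)]
  rw [← pairLeft_apply, map_sum, Finset.sum_eq_single n]
  · rw [← smul_eq_C_mul, map_smul, pairLeft_apply, pair_X_pow_typeI hL le_rfl]
    simp
  · intro i hi hin
    rw [← smul_eq_C_mul, map_smul, pairLeft_apply,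
      pair_X_pow_typeI hL (Nat.lt_succ_iff.mp (Finset.mem_range.mp hi)), if_neg hin, smul_zero]
  · simp

theorem degree_typeII_tail (ν : Fin 3 → ℂ[X] → ℂ) (n : ℕ) :
    (∑ i : Fin n, C (∑ j : Fin n, moment ν n j * (momentMatrix ν n)⁻¹ j i) *
      (X : ℂ[X]) ^ (i : ℕ)).degree < n := by
  refine (degree_sum_le _ _).trans_lt ?_
  refine (Finset.sup_lt_iff (WithBot.bot_lt_coe n)).mpr fun i _ => ?_
  exact (degree_C_mul_X_pow_le _ _).trans_lt (Nat.cast_lt.mpr i.2)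

theorem monic_typeII (ν : Fin 3 → ℂ[X] → ℂ) (n : ℕ) : (typeII ν n).Monic :=
  monic_X_pow_sub (degree_typeII_tail ν n)

theorem natDegree_typeII (ν : Fin 3 → ℂ[X] → ℂ) (n : ℕ) : (typeII ν n).natDegree = n := by
  have h : (typeII ν n).degree = n := by
    rw [typeII, degree_sub_eq_left_of_degree_lt, degree_X_pow]
    rw [degree_X_pow]
    exact degree_typeII_tail ν n
  exact natDegree_eq_of_degree_eq_some h

/-- Pairing the subtracted tail with a step-line monomial contracts a moment row with M⁻¹M, which
reproduces the moment of x^n and cancels it. -/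
theorem pair_typeII {L : Fin 3 → ℂ[X] →ₗ[ℂ] ℂ} (hL : GaussBorel fun a => L a) {n : ℕ}
    {p : Fin 3 → ℂ[X]} (hp : StepLt n p) : pair L (typeII (fun a => L a) n) p = 0 := by
  rw [hp.eq_sum, map_sum]
  refine Finset.sum_eq_zero fun k _ => ?_
  rw [map_smul, ← pairLeft_apply, typeII, map_sub, map_sum]
  simp only [← smul_eq_C_mul, map_smul, pairLeft_apply, pair_X_pow_stepMonomial]
  have h : ∑ i : Fin n, (∑ j : Fin n, moment (fun a => L a) n j *
      (momentMatrix (fun a => L a) n)⁻¹ j i) * moment (fun a => L a) i k =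
      moment (fun a => L a) n k := by
    have := congrFun (Matrix.vecMul_vecMul (fun j : Fin n => moment (fun a => L a) n j)
      (momentMatrix (fun a => L a) n)⁻¹ (momentMatrix (fun a => L a) n)) k
    rw [Matrix.nonsing_inv_mul _ (hL n).isUnit, Matrix.vecMul_one] at this
    rw [← this]
    simp [Matrix.vecMul, dotProduct, momentMatrix]
  simp only [smul_eq_mul]
  rw [h, sub_self, mul_zero]

theorem pair_typeII_typeI {L : Fin 3 → ℂ[X] →ₗ[ℂ] ℂ} (hL : GaussBorel fun a => L a) (m n : ℕ) :
    pair L (typeII (fun a => L a) m) (typeI (fun a => L a) n) = if m = n then 1 else 0 := by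
  rcases lt_or_ge n m with h | h
  · rw [if_neg h.ne', pair_typeII hL ((stepLt_typeI _ n).mono h)]
  · rw [pair_typeI hL (by rwa [natDegree_typeII])]
    split_ifs with hmn
    · subst hmn
      have := (monic_typeII (fun a => L a) m).coeff_natDegree
      rwa [natDegree_typeII] at this
    · exact coeff_eq_zero_of_natDegree_lt (by rw [natDegree_typeII]; omega)

/-- A functional vanishing on monic polynomials of degrees `0, …, N - 1` vanishes on the
monomials of degree less than `N`. -/
theorem map_X_pow_eq_zero_of_monic {Λ : ℂ[X] →ₗ[ℂ] ℂ} {b : ℕ → ℂ[X]} (hb : ∀ m, (b m).Monic)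
    (hd : ∀ m, (b m).natDegree = m) {N : ℕ} (h : ∀ m < N, Λ (b m) = 0) : ∀ m < N, Λ (X ^ m) = 0 := by
  intro m
  induction m using Nat.strong_induction_on with
  | _ m ih =>
    intro hm
    have h1 := (hb m).as_sum
    have h2 := h m hm
    rw [h1, map_add, hd, map_sum, Finset.sum_eq_zero, add_zero] at h2
    · exact h2
    · intro i hi
      have := Finset.mem_range.mp hi
      rw [← smul_eq_C_mul, map_smul, ih i this (this.trans hm), smul_zero]

/-- Expansion in the type I polynomials. -/
theorem StepLt.eq_sum_typeI {L : Fin 3 → ℂ[X] →ₗ[ℂ] ℂ} (hL : GaussBorel fun a => L a) {N : ℕ}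
    {p : Fin 3 → ℂ[X]} (hp : StepLt N p) :
    p = ∑ k ∈ Finset.range N,
      pair L (typeII (fun a => L a) k) p • typeI (fun a => L a) k := by
  rw [← sub_eq_zero]
  refine StepLt.eq_zero hL (N := N) (hp.sub (StepLt.sum _ fun k hk =>
    ((stepLt_typeI _ k).mono (Finset.mem_range.mp hk)).smul _)) ?_
  -- The monomials may be replaced by the type II polynomials as test functions; there
  -- biorthogonality reads off each coefficient.
  refine map_X_pow_eq_zero_of_monic (Λ := pairLeft L _) (monic_typeII fun a => L a)
    (natDegree_typeII fun a => L a) fun m hm => ?_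
  rw [pairLeft_apply, map_sub, map_sum, Finset.sum_eq_single m]
  · simp [pair_typeII_typeI hL]
  · intro k _ hk
    simp [pair_typeII_typeI hL, Ne.symm hk]
  · exact fun h => absurd (Finset.mem_range.mpr hm) h

/-- Uniqueness of the type II polynomials. -/
theorem eq_typeII {L : Fin 3 → ℂ[X] →ₗ[ℂ] ℂ} (hL : GaussBorel fun a => L a) {n : ℕ} {f : ℂ[X]}
    (hf : f.Monic) (hd : f.natDegree = n) (h : ∀ p, StepLt n p → pair L f p = 0) :
    typeII (fun a => L a) n = f := by
  set g := typeII (fun a => L a) n - f with hg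
  have hdeg : g.degree < n := by
    have h1 : (typeII (fun a => L a) n).degree = n := by
      rw [degree_eq_natDegree (monic_typeII _ n).ne_zero, natDegree_typeII]
    have h2 : f.degree = n := by rw [degree_eq_natDegree hf.ne_zero, hd]
    rw [← h1]
    exact degree_sub_lt_left (h1.trans h2.symm) (monic_typeII _ n).ne_zero
      ((monic_typeII _ n).leadingCoeff.trans hf.leadingCoeff.symm)
  have hz : ∀ p, StepLt n p → pair L g p = 0 := by
    intro p hp
    rw [← pairLeft_apply, hg, map_sub, pairLeft_apply, pairLeft_apply, pair_typeII hL hp, h p hp,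
      sub_zero]
  rw [← sub_eq_zero, ← hg]
  by_contra hne
  have hlt : g.natDegree < n := (natDegree_lt_iff_degree_lt hne).mpr hdeg
  -- If nonzero, the difference pairs with the type I polynomial of index its own degree to give its
  -- leading coefficient.
  have := hz _ ((stepLt_typeI (fun a => L a) g.natDegree).mono hlt)
  rw [pair_typeI hL le_rfl] at this
  exact hne (leadingCoeff_eq_zero.mp this)

/-! ### Multiplication by P₁ and its image -/

/-- Multiplication of a column of polynomials by the matrix polynomial `P₁`. -/
def mulP₁ (d : ℂ) (p : Fin 3 → ℂ[X]) : Fin 3 → ℂ[X] :=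
  ![(X - C d) * p 1, (X - C d) * p 2, p 0]

/-- Multiplication of a row of functionals by the matrix polynomial `P₁`. -/
def functionalMulP₁ (d : ℂ) (Φ : Fin 3 → ℂ[X] →ₗ[ℂ] ℂ) : Fin 3 → ℂ[X] →ₗ[ℂ] ℂ :=
  ![Φ 2, Φ 0 ∘ₗ LinearMap.mulLeft ℂ (X - C d), Φ 1 ∘ₗ LinearMap.mulLeft ℂ (X - C d)]

theorem pair_mulP₁ (d : ℂ) (Φ : Fin 3 → ℂ[X] →ₗ[ℂ] ℂ) (f : ℂ[X]) (p : Fin 3 → ℂ[X]) :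
    pair Φ f (mulP₁ d p) = pair (functionalMulP₁ d Φ) f p := by
  simp only [pair_apply, Fin.sum_univ_three, mulP₁, functionalMulP₁, Matrix.cons_val,
    LinearMap.comp_apply, LinearMap.mulLeft_apply]
  rw [mul_left_comm f, mul_left_comm f]
  ring

/-- In the first two entries the factor x - d adds 3 to the step index and the component shift
removes 1; in the last entry the shift adds 2. -/
theorem stepLt_mulP₁ {d : ℂ} {n : ℕ} {p : Fin 3 → ℂ[X]} (hp : StepLt n p) :
    StepLt (n + 2) (mulP₁ d p) := by
  have key : ∀ (b : Fin 3) (l : ℕ), n + 3 ≤ 3 * l + b → ((X - C d) * p b).coeff l = 0 := by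
    intro b l h
    obtain ⟨l, rfl⟩ : ∃ k, l = k + 1 := ⟨l - 1, by omega⟩
    rw [sub_mul, coeff_sub, coeff_X_mul, coeff_C_mul, hp b l (by omega), hp b (l + 1) (by omega)]
    simp
  intro a l h
  fin_cases a
  · exact key 1 l (by simp at h ⊢; omega)
  · exact key 2 l (by simp at h ⊢; omega)
  · exact hp 0 l (by simp at h ⊢; omega)

/-- Otherwise the leading coefficient of q reappears in the product one degree higher. -/
theorem coeff_eq_zero_of_X_sub_C_mul {d : ℂ} {q : ℂ[X]} {l : ℕ}
    (h : ∀ m, l + 1 ≤ m → ((X - C d) * q).coeff m = 0) : q.coeff l = 0 := by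
  by_contra hl
  have hq : q ≠ 0 := by rintro rfl; simp at hl
  have h1 := h (q.natDegree + 1) (Nat.succ_le_succ (le_natDegree_of_ne_zero hl))
  rw [sub_mul, coeff_sub, coeff_X_mul, coeff_C_mul,
    coeff_eq_zero_of_natDegree_lt (Nat.lt_succ_self q.natDegree), mul_zero, sub_zero] at h1
  exact hq (leadingCoeff_eq_zero.mp h1)

/-- The factor theorem divides the first two components by x - d, and the length bound drops back by
2. -/
theorem exists_mulP₁_eq {d : ℂ} {n : ℕ} {r : Fin 3 → ℂ[X]} (hr : StepLt (n + 2) r)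
    (h0 : (r 0).eval d = 0) (h1 : (r 1).eval d = 0) : ∃ p, StepLt n p ∧ mulP₁ d p = r := by
  obtain ⟨s, hs⟩ := dvd_iff_isRoot.mpr h0
  obtain ⟨t, ht⟩ := dvd_iff_isRoot.mpr h1
  refine ⟨![r 2, s, t], ?_, ?_⟩
  · intro a l h
    fin_cases a
    · exact hr 2 l (by simp at h ⊢; omega)
    · refine coeff_eq_zero_of_X_sub_C_mul (d := d) fun m hm => ?_
      change ((X - C d) * s).coeff m = 0
      rw [← hs]
      exact hr 0 m (by simp at h ⊢; omega)
    · refine coeff_eq_zero_of_X_sub_C_mul (d := d) fun m hm => ?_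
      change ((X - C d) * t).coeff m = 0
      rw [← ht]
      exact hr 1 m (by simp at h ⊢; omega)
  · funext a
    fin_cases a
    · exact hs.symm
    · exact ht.symm
    · rfl

/-! ### Christoffel formulas for abstract functionals -/

section Christoffel

variable {L Φ : Fin 3 → ℂ[X] →ₗ[ℂ] ℂ} {c d : ℂ}

theorem pair_X_sub_C_mul (h : ∀ a f, Φ a ((C c - X) * f) = L a f) (f : ℂ[X])
    (p : Fin 3 → ℂ[X]) : pair Φ ((X - C c) * f) p = -pair L f p := by
  have : ∀ a, (X - C c) * f * p a = -((C c - X) * (f * p a)) := fun a => by ring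
  simp only [pair_apply, this, map_neg, h, Finset.sum_neg_distrib]

/-- The conditions at `c` and `d` satisfied by the image of `mulP₁`. -/
def boundary (Φ : Fin 3 → ℂ[X] →ₗ[ℂ] ℂ) (d : ℂ) (b : Fin 3) : (Fin 3 → ℂ[X]) →ₗ[ℂ] ℂ :=
  ![leval d ∘ₗ LinearMap.proj 0, leval d ∘ₗ LinearMap.proj 1, pair Φ 1] b

/-- The determinant of boundary values of three type I polynomials. -/
def boundaryDet (L Φ : Fin 3 → ℂ[X] →ₗ[ℂ] ℂ) (d : ℂ) (i j k : ℕ) : ℂ :=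
  (Matrix.of fun b s => boundary Φ d b (typeI (fun a => L a) (![i, j, k] s))).det

theorem boundary_mulP₁_zero (p : Fin 3 → ℂ[X]) : boundary Φ d 0 (mulP₁ d p) = 0 := by
  simp [boundary, mulP₁, leval]

theorem boundary_mulP₁_one (p : Fin 3 → ℂ[X]) : boundary Φ d 1 (mulP₁ d p) = 0 := by
  simp [boundary, mulP₁, leval]

theorem boundary_mulP₁_two (p : Fin 3 → ℂ[X]) :
    boundary Φ d 2 (mulP₁ d p) = pair (functionalMulP₁ d Φ) 1 p := by
  rw [← pair_mulP₁]
  rfl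

/-- A kernel vector gives a combination R of three consecutive type I polynomials with zero boundary
values. Then R = P₁p with p of length n + 1 orthogonal to every polynomial of degree at most n for
the perturbed row, so p = 0 and R = 0, and biorthogonality kills the coefficients. -/
theorem boundaryDet_ne_zero (h : ∀ a f, Φ a ((C c - X) * f) = L a f)
    (hL : GaussBorel fun a => L a) (hΦ : GaussBorel fun a => functionalMulP₁ d Φ a) (n : ℕ) :
    boundaryDet L Φ d n (n + 1) (n + 2) ≠ 0 := by
  intro hdet
  obtain ⟨v, hv, hTv⟩ := Matrix.exists_mulVec_eq_zero_iff.mpr hdet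
  apply hv
  set A := typeI (fun a => L a) with hA
  set R : Fin 3 → ℂ[X] := ∑ s : Fin 3, v s • A (n + s) with hR
  have hidx : ∀ s : Fin 3, (![n, n + 1, n + 2] : Fin 3 → ℕ) s = n + s := by
    intro s; fin_cases s <;> rfl
  have hb : ∀ b, boundary Φ d b R = 0 := by
    intro b
    have := congrFun hTv b
    simp only [Matrix.mulVec, dotProduct, Matrix.of_apply, hidx, Pi.zero_apply] at this
    rw [hR, map_sum, ← this]
    exact Finset.sum_congr rfl fun s _ => by rw [map_smul, smul_eq_mul, mul_comm]
  have hRs : StepLt (n + 1 + 2) R :=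
    StepLt.sum _ fun s _ => ((stepLt_typeI _ _).mono (by omega)).smul _
  obtain ⟨p, hp, hpR⟩ := exists_mulP₁_eq hRs (hb 0) (hb 1)
  have hpair : ∀ f, pair L (typeII (fun a => L a) f) R =
      ∑ s : Fin 3, v s * if f = n + s then 1 else 0 := by
    intro f
    rw [hR, map_sum]
    exact Finset.sum_congr rfl fun s _ => by
      rw [map_smul, hA, pair_typeII_typeI hL, smul_eq_mul]
  have hp0 : p = 0 := by
    refine hp.eq_zero hΦ ?_
    -- Test functions 1 and (x - c)B_{m-1}, one monic polynomial in each degree: the first is the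
    -- third boundary condition, the others reduce to pairings of B_{m-1} with R, zero since m - 1 <
    -- n.
    refine map_X_pow_eq_zero_of_monic (Λ := pairLeft (functionalMulP₁ d Φ) p)
      (b := fun m => if m = 0 then 1 else (X - C c) * typeII (fun a => L a) (m - 1)) ?_ ?_ ?_
    · intro m
      split_ifs
      · exact monic_one
      · exact (monic_X_sub_C c).mul (monic_typeII _ _)
    · intro m
      split_ifs with hm
      · simp [hm]
      · rw [(monic_X_sub_C c).natDegree_mul (monic_typeII _ _), natDegree_typeII,
          natDegree_X_sub_C]
        omega
    · intro m hm
      rw [pairLeft_apply, ← pair_mulP₁, hpR]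
      split_ifs with h0
      · exact hb 2
      · rw [pair_X_sub_C_mul h, hpair, neg_eq_zero]
        exact Finset.sum_eq_zero fun s _ => by rw [if_neg (by omega), mul_zero]
  have hR0 : R = 0 := by
    rw [← hpR, hp0]
    funext a
    fin_cases a <;> simp [mulP₁]
  funext s
  have := hpair (n + s)
  rw [hR0, map_zero, Finset.sum_eq_single s] at this
  · simpa using this.symm
  · intro t _ hts
    rw [if_neg, mul_zero]
    intro h'
    exact hts (Fin.ext (by omega))
  · simp

theorem boundaryDet_eq (i j k : ℕ) : boundaryDet L Φ d i j k =
    !![boundary Φ d 0 (typeI (fun a => L a) i), boundary Φ d 0 (typeI (fun a => L a) j),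
        boundary Φ d 0 (typeI (fun a => L a) k);
      boundary Φ d 1 (typeI (fun a => L a) i), boundary Φ d 1 (typeI (fun a => L a) j),
        boundary Φ d 1 (typeI (fun a => L a) k);
      boundary Φ d 2 (typeI (fun a => L a) i), boundary Φ d 2 (typeI (fun a => L a) j),
        boundary Φ d 2 (typeI (fun a => L a) k)].det := by
  simp [boundaryDet, Matrix.det_fin_three]

/-- The image of a perturbed type I polynomial in terms of four type I polynomials. -/
theorem exists_mulP₁_typeI_eq (h : ∀ a f, Φ a ((C c - X) * f) = L a f)
    (hL : GaussBorel fun a => L a) (hΦ : GaussBorel fun a => functionalMulP₁ d Φ a) (m : ℕ) :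
    ∃ r₁ r₂ r₃ : ℂ, mulP₁ d (typeI (fun a => functionalMulP₁ d Φ a) (m + 1)) =
      -typeI (fun a => L a) m + r₁ • typeI (fun a => L a) (m + 1)
        + r₂ • typeI (fun a => L a) (m + 2) + r₃ • typeI (fun a => L a) (m + 3) := by
  set Q := mulP₁ d (typeI (fun a => functionalMulP₁ d Φ a) (m + 1)) with hQ
  have hQs : StepLt (m + 4) Q := stepLt_mulP₁ (stepLt_typeI _ _)
  -- Up to sign this is the perturbed pairing with (x - c)B_k, of degree k + 1 ≤ m + 1, from which
  -- the type I polynomial of index m + 1 extracts the coefficient of x^(m+1).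
  have hc : ∀ k ≤ m, pair L (typeII (fun a => L a) k) Q = if k = m then -1 else 0 := by
    intro k hk
    have hmon : ((X - C c) * typeII (fun a => L a) k).Monic :=
      (monic_X_sub_C c).mul (monic_typeII _ _)
    have hdeg : ((X - C c) * typeII (fun a => L a) k).natDegree = k + 1 := by
      rw [(monic_X_sub_C c).natDegree_mul (monic_typeII _ _), natDegree_typeII,
          natDegree_X_sub_C, add_comm]
    have h1 := pair_X_sub_C_mul h (typeII (fun a => L a) k) Q
    rw [hQ, pair_mulP₁, pair_typeI hΦ (by omega), ← hQ] at h1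
    rw [eq_neg_iff_add_eq_zero, add_comm, ← eq_neg_iff_add_eq_zero] at h1
    rw [h1]
    split_ifs with hkm
    · subst hkm
      rw [← hdeg, hmon.coeff_natDegree]
    · rw [coeff_eq_zero_of_natDegree_lt (by omega), neg_zero]
  have hsum := hQs.eq_sum_typeI hL
  rw [Finset.sum_range_succ, Finset.sum_range_succ, Finset.sum_range_succ, Finset.sum_range_succ,
    Finset.sum_eq_zero, hc m le_rfl, if_pos rfl, neg_one_smul, zero_add] at hsum
  · exact ⟨_, _, _, hsum⟩
  · intro k hk
    have := Finset.mem_range.mp hk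
    rw [hc k this.le, if_neg this.ne, zero_smul]

/-- Subtracting the combination of the lower rows turns the first row into (-q, 0, 0, 0); the
remaining minor is the transpose of the 3 × 3 matrix. -/
theorem det_four_of_relation {u v w p : Fin 4 → ℂ} {q r₁ r₂ r₃ : ℂ}
    (hu : 0 = -u 0 + r₁ * u 1 + r₂ * u 2 + r₃ * u 3)
    (hv : 0 = -v 0 + r₁ * v 1 + r₂ * v 2 + r₃ * v 3)
    (hw : 0 = -w 0 + r₁ * w 1 + r₂ * w 2 + r₃ * w 3)
    (hp : q = -p 0 + r₁ * p 1 + r₂ * p 2 + r₃ * p 3) :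
    !![p 0, u 0, v 0, w 0; p 1, u 1, v 1, w 1; p 2, u 2, v 2, w 2; p 3, u 3, v 3, w 3].det =
      -(q * !![u 1, u 2, u 3; v 1, v 2, v 3; w 1, w 2, w 3].det) := by
  have hu' : u 0 = r₁ * u 1 + r₂ * u 2 + r₃ * u 3 := by linear_combination hu
  have hv' : v 0 = r₁ * v 1 + r₂ * v 2 + r₃ * v 3 := by linear_combination hv
  have hw' : w 0 = r₁ * w 1 + r₂ * w 2 + r₃ * w 3 := by linear_combination hw
  have hp' : p 0 = r₁ * p 1 + r₂ * p 2 + r₃ * p 3 - q := by linear_combination hp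
  rw [hu', hv', hw', hp', Matrix.det_succ_row_zero]
  simp [Fin.sum_univ_succ, Matrix.det_fin_three, Fin.succAbove, Matrix.submatrix_apply]
  ring

/-- Christoffel formula for the type I polynomials. -/
theorem mulP₁_typeI_eval (h : ∀ a f, Φ a ((C c - X) * f) = L a f)
    (hL : GaussBorel fun a => L a) (hΦ : GaussBorel fun a => functionalMulP₁ d Φ a) (m : ℕ)
    (x : ℂ) (a : Fin 3) :
    (mulP₁ d (typeI (fun a => functionalMulP₁ d Φ a) (m + 1)) a).eval x =
      -(1 / boundaryDet L Φ d (m + 1) (m + 2) (m + 3)) *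
        (Matrix.of fun s : Fin 4 => ![(typeI (fun a => L a) (m + s) a).eval x,
          boundary Φ d 0 (typeI (fun a => L a) (m + s)),
          boundary Φ d 1 (typeI (fun a => L a) (m + s)),
          boundary Φ d 2 (typeI (fun a => L a) (m + s))]).det := by
  have hτ := boundaryDet_ne_zero h hL hΦ (m + 1)
  obtain ⟨r₁, r₂, r₃, hQ⟩ := exists_mulP₁_typeI_eq h hL hΦ m
  have hb : ∀ b, boundary Φ d b (mulP₁ d (typeI (fun a => functionalMulP₁ d Φ a) (m + 1))) = 0 := by
    intro b
    fin_cases b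
    · exact boundary_mulP₁_zero _
    · exact boundary_mulP₁_one _
    · refine (boundary_mulP₁_two _).trans ?_
      -- The constant 1 has no coefficient in degree m + 1; this is where n > 0 enters.
      rw [pair_typeI hΦ (by simp), coeff_one, if_neg (by omega)]
  rw [hQ] at hb
  simp only [map_add, map_neg, map_smul, smul_eq_mul] at hb
  have hx := congrArg (fun q : Fin 3 → ℂ[X] => (q a).eval x) hQ
  simp only [Pi.add_apply, Pi.neg_apply, Pi.smul_apply, eval_add, eval_neg, eval_smul,
    smul_eq_mul] at hx
  have key := det_four_of_relation
    (u := fun s => boundary Φ d 0 (typeI (fun a => L a) (m + s)))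
    (v := fun s => boundary Φ d 1 (typeI (fun a => L a) (m + s)))
    (w := fun s => boundary Φ d 2 (typeI (fun a => L a) (m + s)))
    (p := fun s => (typeI (fun a => L a) (m + s) a).eval x)
    (hb 0).symm (hb 1).symm (hb 2).symm hx
  have hdet : boundaryDet L Φ d (m + 1) (m + 2) (m + 3) = _ := boundaryDet_eq _ _ _
  have hmat : ∀ f : Fin 4 → Fin 4 → ℂ, Matrix.of f = !![f 0 0, f 0 1, f 0 2, f 0 3;
      f 1 0, f 1 1, f 1 2, f 1 3; f 2 0, f 2 1, f 2 2, f 2 3; f 3 0, f 3 1, f 3 2, f 3 3] := by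
    intro f
    ext i j
    fin_cases i <;> fin_cases j <;> rfl
  rw [hmat]
  have key' := key.trans (congrArg (fun t => -(_ * t)) hdet.symm)
  refine Eq.trans ?_ (congrArg (fun t =>
    -(1 / boundaryDet L Φ d (m + 1) (m + 2) (m + 3)) * t) key'.symm)
  field_simp

/-- Christoffel formula for the type II polynomials. -/
theorem typeII_functionalMulP₁ (h : ∀ a f, Φ a ((C c - X) * f) = L a f)
    (hL : GaussBorel fun a => L a) (hΦ : GaussBorel fun a => functionalMulP₁ d Φ a) (n : ℕ) :
    typeII (fun a => functionalMulP₁ d Φ a) (n + 1) =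
      (X - C c) * typeII (fun a => L a) n +
        ((1 / boundaryDet L Φ d n (n + 1) (n + 2)) • ((X - C c) *
            ∑ i ∈ Finset.range n,
              boundaryDet L Φ d i (n + 1) (n + 2) • typeII (fun a => L a) i) +
          (1 / boundaryDet L Φ d n (n + 1) (n + 2) *
            !![boundary Φ d 0 (typeI (fun a => L a) (n + 1)),
                boundary Φ d 0 (typeI (fun a => L a) (n + 2));
              boundary Φ d 1 (typeI (fun a => L a) (n + 1)),
                boundary Φ d 1 (typeI (fun a => L a) (n + 2))].det) • 1) := by
  have hτ := boundaryDet_ne_zero h hL hΦ n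
  have hmon : ((X - C c) * typeII (fun a => L a) n).Monic :=
    (monic_X_sub_C c).mul (monic_typeII _ _)
  have hdeg : ((X - C c) * typeII (fun a => L a) n).natDegree = n + 1 := by
    rw [(monic_X_sub_C c).natDegree_mul (monic_typeII _ _), natDegree_typeII,
      natDegree_X_sub_C, add_comm]
  have hdeg' : ((X - C c) * typeII (fun a => L a) n).degree = ((n + 1 : ℕ) : WithBot ℕ) := by
    rw [degree_eq_natDegree hmon.ne_zero, hdeg]
  set m := !![boundary Φ d 0 (typeI (fun a => L a) (n + 1)),
                boundary Φ d 0 (typeI (fun a => L a) (n + 2));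
              boundary Φ d 1 (typeI (fun a => L a) (n + 1)),
                boundary Φ d 1 (typeI (fun a => L a) (n + 2))].det with hm
  set S := ∑ i ∈ Finset.range n,
    boundaryDet L Φ d i (n + 1) (n + 2) • typeII (fun a => L a) i with hS
  set τ₀ := boundaryDet L Φ d n (n + 1) (n + 2) with hτ₀
  have hSdeg : S.degree < n := by
    refine (degree_sum_le _ _).trans_lt ?_
    refine (Finset.sup_lt_iff (WithBot.bot_lt_coe n)).mpr fun i hi => ?_
    refine (degree_smul_le _ _).trans_lt ?_
    rw [degree_eq_natDegree (monic_typeII _ i).ne_zero, natDegree_typeII]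
    exact Nat.cast_lt.mpr (Finset.mem_range.mp hi)
  have hlow : ((1 / τ₀) • ((X - C c) * S) + (1 / τ₀ * m) • (1 : ℂ[X])).degree <
      ((X - C c) * typeII (fun a => L a) n).degree := by
    rw [hdeg']
    refine (degree_add_le _ _).trans_lt (max_lt ?_ ?_)
    · refine (degree_smul_le _ _).trans_lt ?_
      rw [mul_comm, degree_mul, degree_X_sub_C]
      push_cast
      exact WithBot.add_lt_add_right (by simp) hSdeg
    · refine (degree_smul_le _ _).trans_lt ?_
      rw [degree_one]
      exact_mod_cast Nat.succ_pos n
  refine eq_typeII hΦ (hmon.add_of_left hlow) ?_ ?_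
  · refine natDegree_eq_of_degree_eq_some ?_
    rw [degree_add_eq_left_of_degree_lt hlow, hdeg']
  intro p hp
  have hRs : StepLt (n + 3) (mulP₁ d p) := stepLt_mulP₁ hp
  have hb0 := boundary_mulP₁_zero (Φ := Φ) (d := d) p
  have hb1 := boundary_mulP₁_one (Φ := Φ) (d := d) p
  rw [← pair_mulP₁]
  set R := mulP₁ d p
  have hsum := hRs.eq_sum_typeI hL
  set r := fun k => pair L (typeII (fun a => L a) k) R with hr
  have hbsum : ∀ b, boundary Φ d b R =
      ∑ k ∈ Finset.range (n + 3), r k * boundary Φ d b (typeI (fun a => L a) k) := by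
    intro b
    conv_lhs => rw [hsum]
    rw [map_sum]
    exact Finset.sum_congr rfl fun k _ => by rw [map_smul, smul_eq_mul]
  -- Expanding each determinant along its first column and summing leaves only the third boundary
  -- value, since the first two vanish on R.
  have hcramer : ∑ k ∈ Finset.range (n + 3), r k * boundaryDet L Φ d k (n + 1) (n + 2) =
      boundary Φ d 2 R * m := by
    rw [hbsum 0] at hb0
    rw [hbsum 1] at hb1
    have : ∀ k, r k * boundaryDet L Φ d k (n + 1) (n + 2) =
        r k * boundary Φ d 0 (typeI (fun a => L a) k) *
          (boundary Φ d 1 (typeI (fun a => L a) (n + 1)) *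
              boundary Φ d 2 (typeI (fun a => L a) (n + 2)) -
            boundary Φ d 1 (typeI (fun a => L a) (n + 2)) *
              boundary Φ d 2 (typeI (fun a => L a) (n + 1))) -
        r k * boundary Φ d 1 (typeI (fun a => L a) k) *
          (boundary Φ d 0 (typeI (fun a => L a) (n + 1)) *
              boundary Φ d 2 (typeI (fun a => L a) (n + 2)) -
            boundary Φ d 0 (typeI (fun a => L a) (n + 2)) *
              boundary Φ d 2 (typeI (fun a => L a) (n + 1))) +
        r k * boundary Φ d 2 (typeI (fun a => L a) k) * m := by
      intro k
      rw [boundaryDet_eq, Matrix.det_fin_three, hm, Matrix.det_fin_two]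
      simp only [Matrix.of_apply, Matrix.cons_val]
      ring
    simp only [this, Finset.sum_add_distrib, Finset.sum_sub_distrib, ← Finset.sum_mul, hb0, hb1,
      ← hbsum 2]
    ring
  -- Repeated columns: the sum over k < n + 3 really stops at k = n.
  have h1 : boundaryDet L Φ d (n + 1) (n + 1) (n + 2) = 0 := by
    rw [boundaryDet_eq, Matrix.det_fin_three]
    simp only [Matrix.of_apply, Matrix.cons_val]
    ring
  have h2 : boundaryDet L Φ d (n + 2) (n + 1) (n + 2) = 0 := by
    rw [boundaryDet_eq, Matrix.det_fin_three]
    simp only [Matrix.of_apply, Matrix.cons_val]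
    ring
  rw [Finset.sum_range_succ, Finset.sum_range_succ, Finset.sum_range_succ, h1, h2] at hcramer
  have hSr : pair L S R =
      ∑ k ∈ Finset.range n, r k * boundaryDet L Φ d k (n + 1) (n + 2) := by
    rw [← pairLeft_apply, hS, map_sum]
    exact Finset.sum_congr rfl fun k _ => by
      rw [map_smul, pairLeft_apply, smul_eq_mul, mul_comm]
  rw [pair_add_left, pair_add_left, pair_smul_left, pair_smul_left, pair_X_sub_C_mul h,
    pair_X_sub_C_mul h, hSr]
  change -r n + (1 / τ₀ * _ + 1 / τ₀ * m * boundary Φ d 2 R) = 0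
  field_simp
  linear_combination -hcramer

end Christoffel

/-! ### Nonsingularity of Beta-function matrices -/

open Complex in
-- The Gamma prefactor does not depend on i, so a linear relation among these values over i ≤ m
-- becomes a polynomial equation in u.
theorem betaIntegral_add_nat {u v : ℂ} (hu : 0 < u.re) (hv : 0 < v.re) {i m : ℕ} (hi : i ≤ m) :
    betaIntegral (u + i) v = Gamma u * Gamma v / Gamma (u + v + m) *
      ((ascPochhammer ℂ i).eval u * (ascPochhammer ℂ (m - i)).eval (u + v + i)) := by
  have hne : ∀ z : ℂ, 0 < z.re → ∀ k : ℕ, z ≠ -k := by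
    rintro z hz k rfl
    simp at hz
    exact absurd hz (not_lt.mpr (Nat.cast_nonneg k))
  have hui : 0 < (u + i).re := by simp; positivity
  have huvi : 0 < (u + v + i).re := by simp; positivity
  have huvm : 0 < (u + v + m).re := by simp; positivity
  rw [betaIntegral_eq_Gamma_mul_div _ _ hui hv, ← Gamma_add_nat_div_Gamma_eq u (hne u hu),
    ← Gamma_add_nat_div_Gamma_eq _ (hne _ huvi), add_assoc (u + v), ← Nat.cast_add,
    Nat.add_sub_cancel' hi, add_right_comm u]
  have h1 := Gamma_ne_zero_of_re_pos hu
  have h2 := Gamma_ne_zero_of_re_pos huvi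
  have h3 := Gamma_ne_zero_of_re_pos huvm
  field_simp

/-- The polynomial `∑ v_i (u)_i (u + v + i)_{m - i}` in `u`. -/
def betaPoly (b : ℂ) (m : ℕ) (v : ℕ → ℂ) : ℂ[X] :=
  ∑ i ∈ Finset.range (m + 1),
    v i • (ascPochhammer ℂ i * (ascPochhammer ℂ (m - i)).comp (X + C (b + i)))

theorem betaPoly_eval (b : ℂ) (m : ℕ) (v : ℕ → ℂ) (u : ℂ) :
    (betaPoly b m v).eval u = ∑ i ∈ Finset.range (m + 1),
      v i * ((ascPochhammer ℂ i).eval u * (ascPochhammer ℂ (m - i)).eval (u + b + i)) := by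
  simp [betaPoly, eval_finsetSum, add_assoc]

theorem natDegree_betaPoly_le (b : ℂ) (m : ℕ) (v : ℕ → ℂ) : (betaPoly b m v).natDegree ≤ m := by
  refine natDegree_sum_le_of_forall_le _ _ fun i hi => ?_
  refine (natDegree_smul_le _ _).trans (natDegree_mul_le.trans ?_)
  rw [natDegree_comp, natDegree_X_add_C, ascPochhammer_natDegree, ascPochhammer_natDegree]
  have := Finset.mem_range.mp hi
  omega

theorem ascPochhammer_eval_ne_zero {z : ℂ} (n : ℕ) (h : ∀ k < n, z + k ≠ 0) :
    (ascPochhammer ℂ n).eval z ≠ 0 := by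
  induction n with
  | zero => simp
  | succ n ih =>
    rw [ascPochhammer_succ_eval]
    exact mul_ne_zero (ih fun k hk => h k (by omega)) (h n (by omega))

theorem ascPochhammer_eval_neg_eq_zero {k i : ℕ} (h : k < i) :
    (ascPochhammer ℂ i).eval (-(k : ℂ)) = 0 := by
  induction i with
  | zero => omega
  | succ i ih =>
    rw [ascPochhammer_succ_eval]
    rcases Nat.lt_succ_iff_lt_or_eq.mp h with h | rfl
    · rw [ih h, zero_mul]
    · simp

/-- Evaluation at u = -k is triangular: terms with i > k contain the zero factor (-k)_i, terms with
i < k vanish by induction, and the k-th factor (-k)_k (b)_{m-k} is nonzero. -/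
theorem eq_zero_of_betaPoly_eq_zero {b : ℂ} (hb : 0 < b.re) {m : ℕ} {v : ℕ → ℂ}
    (h : betaPoly b m v = 0) : ∀ k ≤ m, v k = 0 := by
  intro k
  induction k using Nat.strong_induction_on with
  | _ k ih =>
    intro hk
    have h1 := congrArg (eval (-(k : ℂ))) h
    rw [betaPoly_eval, eval_zero, Finset.sum_eq_single k] at h1
    · refine (mul_eq_zero.mp h1).resolve_right (mul_ne_zero ?_ ?_)
      · refine ascPochhammer_eval_ne_zero _ fun j hj hz => ?_
        have : (j : ℂ) = k := by linear_combination hz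
        exact hj.ne (by exact_mod_cast this)
      · refine ascPochhammer_eval_ne_zero _ fun j _ hz => ?_
        have h2 := congrArg Complex.re hz
        simp at h2
        have : (0 : ℝ) ≤ j := Nat.cast_nonneg j
        linarith
    · intro i hi hik
      have := Finset.mem_range.mp hi
      rcases lt_or_gt_of_ne hik with h2 | h2
      · rw [ih i h2 (by omega), zero_mul]
      · rw [ascPochhammer_eval_neg_eq_zero h2, zero_mul, mul_zero]
    · intro h2
      exact absurd (Finset.mem_range.mpr (by omega)) h2

/-- A left kernel vector yields a polynomial of degree less than N with N distinct roots `u j`. -/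
theorem det_betaIntegral_ne_zero {b : ℂ} (hb : 0 < b.re) (N : ℕ) {u : Fin N → ℂ}
    (hu : ∀ j, 0 < (u j).re) (hinj : Function.Injective u) :
    (Matrix.of fun i j : Fin N => Complex.betaIntegral (u j + (i : ℕ)) b).det ≠ 0 := by
  intro hdet
  obtain ⟨v, hv, hvM⟩ := Matrix.exists_vecMul_eq_zero_iff.mpr hdet
  apply hv
  rcases N with _ | m
  · exact Subsingleton.elim _ _
  set v' : ℕ → ℂ := fun i => if h : i < m + 1 then v ⟨i, h⟩ else 0 with hv'
  have hpoly : betaPoly b m v' = 0 := by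
    refine eq_zero_of_natDegree_lt_card_of_eval_eq_zero _ hinj (fun j => ?_)
      ((natDegree_betaPoly_le b m v').trans_lt (by simp))
    have h1 := congrFun hvM j
    simp only [Matrix.vecMul, dotProduct, Matrix.of_apply, Pi.zero_apply] at h1
    rw [betaPoly_eval, Finset.sum_range]
    have hg : Complex.Gamma (u j) * Complex.Gamma b / Complex.Gamma (u j + b + m) ≠ 0 := by
      refine div_ne_zero (mul_ne_zero ?_ ?_) ?_
      · exact Complex.Gamma_ne_zero_of_re_pos (hu j)
      · exact Complex.Gamma_ne_zero_of_re_pos hb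
      · refine Complex.Gamma_ne_zero_of_re_pos ?_
        have := hu j
        simp
        positivity
    refine (mul_eq_zero.mp ?_).resolve_left hg
    rw [← h1, Finset.mul_sum]
    refine Finset.sum_congr rfl fun i _ => ?_
    rw [betaIntegral_add_nat (hu j) hb (Nat.lt_succ_iff.mp i.2)]
    simp only [hv', i.2, dif_pos, Fin.eta]
    ring
  funext i
  have := eq_zero_of_betaPoly_eq_zero hb hpoly i (Nat.lt_succ_iff.mp i.2)
  simpa only [hv', i.2, dif_pos, Fin.eta, Pi.zero_apply] using this

/-! ### Jacobi–Piñeiro functionals and their normality -/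

theorem ofReal_weight {α : Fin 3 → ℝ} {β : ℝ} (a : Fin 3) {x : ℝ} (hx : x ∈ Set.Icc (0 : ℝ) 1) :
    (weight α β a x : ℂ) =
      (x : ℂ) ^ ((α a + 1 : ℂ) - 1) * (1 - (x : ℂ)) ^ ((β + 1 : ℂ) - 1) := by
  rw [weight, Complex.ofReal_mul, Complex.ofReal_cpow hx.1, Complex.ofReal_cpow (by linarith [hx.2])]
  simp

theorem intervalIntegrable_weight {α : Fin 3 → ℝ} {β : ℝ} (hα : ∀ a, -1 < α a) (hβ : -1 < β)
    (a : Fin 3) :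
    IntervalIntegrable (fun x : ℝ => (weight α β a x : ℂ)) MeasureTheory.volume 0 1 := by
  have h := Complex.betaIntegral_convergent (u := α a + 1) (v := β + 1)
    (by simp; linarith [hα a]) (by simp; linarith)
  refine h.congr fun x hx => (ofReal_weight a ?_).symm
  rw [Set.uIoc_of_le zero_le_one] at hx
  exact Set.Ioc_subset_Icc_self hx

theorem intervalIntegrable_eval_mul {g : ℝ → ℂ}
    (hg : IntervalIntegrable g MeasureTheory.volume 0 1) (f : ℂ[X]) :
    IntervalIntegrable (fun x : ℝ => f.eval (x : ℂ) * g x) MeasureTheory.volume 0 1 :=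
  hg.continuousOn_mul (f.continuous.comp Complex.continuous_ofReal).continuousOn

/-- Integration of polynomials against an integrable density. -/
def densityFunctional (g : ℝ → ℂ) (hg : IntervalIntegrable g MeasureTheory.volume 0 1) :
    ℂ[X] →ₗ[ℂ] ℂ where
  toFun f := ∫ x in (0 : ℝ)..1, f.eval (x : ℂ) * g x
  map_add' p q := by
    rw [← intervalIntegral.integral_add (intervalIntegrable_eval_mul hg p)
      (intervalIntegrable_eval_mul hg q)]
    simp only [eval_add, add_mul]
  map_smul' r p := by
    simp only [eval_smul, smul_eq_mul, mul_assoc, intervalIntegral.integral_const_mul,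
      RingHom.id_apply]

theorem moment_jp (α : Fin 3 → ℝ) (β : ℝ) (i j : ℕ) :
    moment (jp α β) i j =
      Complex.betaIntegral ((α (stepComp j) + (j / 3 : ℕ) + 1 : ℂ) + i) (β + 1) := by
  rw [moment, jp, Complex.betaIntegral]
  refine intervalIntegral.integral_congr_ae (Filter.Eventually.of_forall fun x hx => ?_)
  rw [Set.uIoc_of_le zero_le_one] at hx
  have hx0 : (x : ℂ) ≠ 0 := by exact_mod_cast hx.1.ne'
  rw [ofReal_weight _ (Set.Ioc_subset_Icc_self hx), ← mul_assoc]
  congr 1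
  simp only [eval_mul, eval_pow, eval_X]
  rw [← Complex.cpow_natCast, ← Complex.cpow_natCast, ← Complex.cpow_add _ _ hx0,
    ← Complex.cpow_add _ _ hx0]
  congr 1
  ring

/-- Normality of the Jacobi–Piñeiro system on the step line. -/
theorem gaussBorel_jp {α : Fin 3 → ℝ} {β : ℝ} (hα : ∀ a, -1 < α a) (hβ : -1 < β)
    (hαα : ∀ i j, i ≠ j → ∀ k : ℤ, α i - α j ≠ k) : GaussBorel (jp α β) := by
  intro N
  have h := det_betaIntegral_ne_zero (b := β + 1) (by simp; linarith) N
    (u := fun j => (α (stepComp j) + ((j : ℕ) / 3 : ℕ) + 1 : ℂ)) ?_ ?_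
  · convert h using 2
    ext i j
    exact moment_jp α β i j
  · intro j
    have h1 := hα (stepComp j)
    have h2 : (0 : ℝ) ≤ ((j : ℕ) / 3 : ℕ) := Nat.cast_nonneg _
    simp only [Complex.add_re, Complex.ofReal_re, Complex.natCast_re, Complex.one_re]
    linarith
  -- Equal nodes make a difference of exponents an integer, forcing equal components, then equal
  -- quotients by 3, hence equal indices.
  · intro j k hjk
    have h1 : α (stepComp j) + ((j : ℕ) / 3 : ℕ) = α (stepComp k) + ((k : ℕ) / 3 : ℕ) := by
      have := congrArg Complex.re hjk
      simpa only [Complex.add_re, Complex.ofReal_re, Complex.natCast_re, Complex.one_re,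
        add_left_inj] using this
    have h2 : stepComp j = stepComp k := by
      by_contra hne
      apply hαα _ _ hne (((k : ℕ) / 3 : ℕ) - ((j : ℕ) / 3 : ℕ) : ℤ)
      rw [Int.cast_sub, Int.cast_natCast, Int.cast_natCast]
      linarith
    rw [h2, add_right_inj] at h1
    have h3 : (j : ℕ) / 3 = (k : ℕ) / 3 := by exact_mod_cast h1
    have h4 : (j : ℕ) % 3 = (k : ℕ) % 3 := congrArg Fin.val h2
    ext
    omega

/-! ### The perturbed row as Φ P₁ -/

/-- `f ↦ ∫ f dμ_a` as a linear functional. -/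
def jpFunctional (α : Fin 3 → ℝ) (β : ℝ) (hα : ∀ a, -1 < α a) (hβ : -1 < β) (a : Fin 3) :
    ℂ[X] →ₗ[ℂ] ℂ :=
  densityFunctional (fun x => (weight α β a x : ℂ)) (intervalIntegrable_weight hα hβ a)

theorem intervalIntegrable_weight_div {α : Fin 3 → ℝ} {β c : ℝ}
    (hint : ∀ a, IntervalIntegrable (fun x : ℝ => weight α β a x / (c - x))
      MeasureTheory.volume 0 1) (a : Fin 3) :
    IntervalIntegrable (fun x : ℝ => (weight α β a x : ℂ) / ((c : ℂ) - x))
      MeasureTheory.volume 0 1 := by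
  have h := hint a
  rw [intervalIntegrable_iff] at h ⊢
  simpa using! h.ofReal (𝕜 := ℂ)

/-- `f ↦ ∫ f dμ_a / (c - x) + f(c) ξ_a(c)` as a linear functional. -/
def cauchyFunctional (α : Fin 3 → ℝ) (β c : ℝ) (ξ : ℝ → Fin 3 → ℂ)
    (hint : ∀ a, IntervalIntegrable (fun x : ℝ => weight α β a x / (c - x))
      MeasureTheory.volume 0 1) (a : Fin 3) : ℂ[X] →ₗ[ℂ] ℂ :=
  densityFunctional (fun x => (weight α β a x : ℂ) / ((c : ℂ) - x))
    (intervalIntegrable_weight_div hint a) + ξ c a • leval (c : ℂ)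

section

variable {α : Fin 3 → ℝ} {β c : ℝ} {ξ : ℝ → Fin 3 → ℂ} (hα : ∀ a, -1 < α a) (hβ : -1 < β)
  (hint : ∀ a, IntervalIntegrable (fun x : ℝ => weight α β a x / (c - x))
    MeasureTheory.volume 0 1)

theorem cauchyFunctional_apply (a : Fin 3) (f : ℂ[X]) :
    cauchyFunctional α β c ξ hint a f =
      (∫ x in (0 : ℝ)..1, f.eval (x : ℂ) * ((weight α β a x : ℂ) / ((c : ℂ) - x))) +
        f.eval (c : ℂ) * ξ c a := by
  rw [mul_comm (f.eval (c : ℂ))]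
  rfl

/-- The factor c - x kills the point mass at c and cancels the denominator off the null set {c}. -/
theorem cauchyFunctional_C_sub_X_mul (a : Fin 3) (f : ℂ[X]) :
    cauchyFunctional α β c ξ hint a ((C (c : ℂ) - X) * f) = jpFunctional α β hα hβ a f := by
  rw [cauchyFunctional_apply]
  simp only [eval_mul, eval_sub, eval_C, eval_X, sub_self, zero_mul, add_zero]
  refine intervalIntegral.integral_congr_ae ?_
  filter_upwards [MeasureTheory.Measure.ae_ne MeasureTheory.volume c] with x hx _
  have : (c : ℂ) - x ≠ 0 := sub_ne_zero.mpr (by exact_mod_cast hx.symm)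
  field_simp

theorem vecMul_P₁ (w : Fin 3 → ℂ) (d x : ℂ) :
    Matrix.vecMul w (P₁ d x) = ![w 2, (x - d) * w 0, (x - d) * w 1] := by
  funext a
  fin_cases a <;> simp [P₁, Matrix.vecMul, dotProduct, Fin.sum_univ_three, mul_comm]

theorem jpPerturbed_eq (d : ℝ) : jpPerturbed α β c d ξ =
    fun a => ⇑(functionalMulP₁ (d : ℂ) (cauchyFunctional α β c ξ hint) a) := by
  funext a f
  obtain rfl | rfl | rfl : a = 0 ∨ a = 1 ∨ a = 2 := by omega
  all_goals
    simp only [jpPerturbed, vecMul_P₁, functionalMulP₁, Matrix.cons_val, LinearMap.comp_apply,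
      LinearMap.mulLeft_apply, cauchyFunctional_apply, eval_mul, eval_sub, eval_X, eval_C,
      mul_div_assoc, mul_left_comm, mul_assoc]

theorem W_eq_pair (n : ℕ) : W α β ξ n c = pair (cauchyFunctional α β c ξ hint) 1 (P α β n) := by
  simp only [pair_apply, one_mul, cauchyFunctional_apply, Finset.sum_add_distrib, W, cauchyC]
  congr 1
  · rw [← intervalIntegral.integral_finsetSum fun a _ =>
      intervalIntegrable_eval_mul (intervalIntegrable_weight_div hint a) _]
    simp only [Finset.sum_div, mul_div_assoc]
  · exact Finset.sum_congr rfl fun a _ => mul_comm _ _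

theorem boundary_two_eq_W (d : ℂ) (n : ℕ) :
    boundary (cauchyFunctional α β c ξ hint) d 2
      (typeI (fun a => jpFunctional α β hα hβ a) n) = W α β ξ n c :=
  (W_eq_pair hint n).symm

theorem boundaryDet_eq_det₃ (d : ℝ) (i j k : ℕ) :
    boundaryDet (jpFunctional α β hα hβ) (cauchyFunctional α β c ξ hint) d i j k =
      det₃ α β c d ξ i j k := by
  rw [boundaryDet_eq, boundary_two_eq_W, boundary_two_eq_W, boundary_two_eq_W]
  rfl

end

end JacobiPineiro

end

/-! ### Formulas for the perturbed Jacobi–Piñeiro measures -/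

theorem mainTheorem9 (α : Fin 3 → ℝ) (β c d : ℝ) (ξ : ℝ → Fin 3 → ℂ)
    (hα : ∀ a, -1 < α a) (hβ : -1 < β)
    (hαα : ∀ i j, i ≠ j → ∀ k : ℤ, α i - α j ≠ k)
    (hc : c ∈ Set.Iic (0 : ℝ) ∪ Set.Ici 1) (hd : d ∈ Set.Iic (0 : ℝ) ∪ Set.Ici 1)
    (hint : ∀ a, IntervalIntegrable (fun x : ℝ => weight α β a x / (c - x))
      MeasureTheory.volume 0 1)
    (hGB : GaussBorel (jpPerturbed α β c d ξ))
    (n : ℕ) (hn : 0 < n) :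
    τ α β c d ξ n ≠ 0 ∧
    (∀ (x : ℂ) (a : Fin 3),
      (![(x - d) * (typeI (jpPerturbed α β c d ξ) n 1).eval x,
         (x - d) * (typeI (jpPerturbed α β c d ξ) n 2).eval x,
         (typeI (jpPerturbed α β c d ξ) n 0).eval x] : Fin 3 → ℂ) a =
      -(1 / τ α β c d ξ n) *
        !![(P α β (n - 1) a).eval x, (P α β (n - 1) 0).eval (d : ℂ),
              (P α β (n - 1) 1).eval (d : ℂ), W α β ξ (n - 1) c;
           (P α β n a).eval x, (P α β n 0).eval (d : ℂ),
              (P α β n 1).eval (d : ℂ), W α β ξ n c;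
           (P α β (n + 1) a).eval x, (P α β (n + 1) 0).eval (d : ℂ),
              (P α β (n + 1) 1).eval (d : ℂ), W α β ξ (n + 1) c;
           (P α β (n + 2) a).eval x, (P α β (n + 2) 0).eval (d : ℂ),
              (P α β (n + 2) 1).eval (d : ℂ), W α β ξ (n + 2) c].det) ∧
    (∀ x : ℂ,
      (typeII (jpPerturbed α β c d ξ) (n + 1)).eval x =
        (x - c) * (B α β n).eval x
        + (x - c) / τ α β c d ξ n *
            ∑ i ∈ Finset.range n, det₃ α β c d ξ i (n + 1) (n + 2) * (B α β i).eval x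
        + 1 / τ α β c d ξ n *
            !![(P α β (n + 1) 0).eval (d : ℂ), (P α β (n + 2) 0).eval (d : ℂ);
               (P α β (n + 1) 1).eval (d : ℂ), (P α β (n + 2) 1).eval (d : ℂ)].det) := by
  have hL : GaussBorel fun a => jpFunctional α β hα hβ a := gaussBorel_jp hα hβ hαα
  have hΦ : GaussBorel fun a => functionalMulP₁ (d : ℂ) (cauchyFunctional α β c ξ hint) a := by
    rwa [← jpPerturbed_eq hint d]
  have h := cauchyFunctional_C_sub_X_mul (ξ := ξ) hα hβ hint
  have hτ : ∀ m, τ α β c d ξ m = _ := fun m =>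
    (boundaryDet_eq_det₃ (ξ := ξ) hα hβ hint d m (m + 1) (m + 2)).symm
  refine ⟨?_, fun x a => ?_, fun x => ?_⟩
  · rw [hτ]
    exact boundaryDet_ne_zero h hL hΦ n
  -- Writing n = m + 1 removes the truncated subtraction n - 1.
  · obtain ⟨m, rfl⟩ : ∃ m, n = m + 1 := ⟨n - 1, by omega⟩
    have key := mulP₁_typeI_eval h hL hΦ m x a
    rw [← jpPerturbed_eq hint d] at key
    rw [hτ]
    refine Eq.trans ?_ (key.trans ?_)
    · fin_cases a <;> simp [mulP₁]
    · refine congrArg (fun M : Matrix (Fin 4) (Fin 4) ℂ => -(1 / _) * M.det) ?_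
      ext s t
      simp only [boundary_two_eq_W]
      fin_cases s <;> fin_cases t <;> rfl
  · have key := congrArg (eval x) (typeII_functionalMulP₁ h hL hΦ n)
    rw [← jpPerturbed_eq hint d] at key
    refine key.trans ?_
    rw [hτ]
    simp only [boundaryDet_eq_det₃, eval_add, eval_mul, eval_sub, eval_X, eval_C, eval_smul,
      smul_eq_mul, eval_one, mul_one, eval_finsetSum]
    have hB : ∀ i, typeII (fun a => jpFunctional α β hα hβ a) i = B α β i := fun _ => rfl
    simp only [hB]
    rw [add_assoc]
    congr 1
    congr 1
    ring
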